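/- Let $n\geq 1$ and let $G\subseteq S_n$ be a transitive permutation group. For real $X>0$ let $N_n(X;G)$ be the number of number fields $K$ (subfields of a fixed algebraic closure $\overline{\mathbb{Q}}$) such that $[K:\mathbb{Q}]=n$, $|\Delta_K|\leq X$, and the Galois group over $\mathbb{Q}$ of the Galois closure $\widetilde K$ of $K$, acting by composition on the $n$ embeddings of $K$ into $\widetilde K$, is isomorphic to $G$ as a permutation group. Let $H$ be the stabilizer of $1$ in $G$, let $N$ be the normalizer of $H$ in $G$, and put $r=|N/H|$. For $i\in\{1,\dots,n\}$ let $g_i\in G$ be an element with $g_i(1)=i$, so that $G/H=\{g_1H,\dots,g_nH\}$. Let $h_1H,\dots,h_rH$ be the elements of $N/H$, enumerated so that $h_1H=H$. For $1\leq j\leq r$ let $\pi_j\in S_n$ be the permutation such that $\pi_j(i)$ is the unique index $m$ with $g_ih_jH=g_mH$. For $\mathbf{a}=(a_1,\dots,a_r)\in\mathbb{Z}_{\geq 0}^r$ define the trace function $$\operatorname{Tr}_{\mathbf a}(x_1,\dots,x_n)=\sum_{i=1}^n\prod_{j=1}^r x_{\pi_j(i)}^{a_j}\in\mathbb{Z}[x_1,\dots,x_n].$$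 Let $t\geq 2$ and $1\leq k\leq r-1$ be integers. For a $k$-element subset $\mathcal{B}\subseteq\{1,\dots,r\}$ that contains $1$, let $\mathbf a(\mathcal B)\in\mathbb{Z}_{\geq 0}^r$ be the vector whose first entry is $t$, whose entry at each $j\in\mathcal B\setminus\{1\}$ is $1$, and whose other entries are $0$. Let $\mathbf a_1,\dots,\mathbf a_l$, where $l=\binom{r-1}{k-1}$, be all the vectors obtained in this way. Assume that 1. $l=\binom{r-1}{k-1}\geq n$, and 2. there are $n$ distinct vectors $\mathbf a_{i_1},\dots,\mathbf a_{i_n}$ among $\mathbf a_1,\dots,\mathbf a_l$ such that, with $f_m=\operatorname{Tr}_{\mathbf a_{i_m}}$, the determinant of the Jacobian matrix $\left(\partial f_m/\partial x_j\right)_{1\leq m,j\leq n}$ is not identically $0$. Then $N_n(X;G)\ll X^{k+t-1}$; that is, there is a constant $C$ such that for every real $X\geq 1$ the number $N_n(X;G)$ is finite and at most $C\,X^{k+t-1}$. -/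

import Mathlib

namespace NumberFieldCount

noncomputable section

/-- The Galois closure over `ℚ` (inside the fixed algebraic closure) of a subfield `K`. -/
abbrev galoisClosure (K : IntermediateField ℚ (AlgebraicClosure ℚ)) :
    IntermediateField ℚ (AlgebraicClosure ℚ) :=
  IntermediateField.normalClosure ℚ K (AlgebraicClosure ℚ)

/-- The Galois group of the Galois closure of `K`, acting on the embeddings of `K` by composition,
is isomorphic to `G` as a permutation group: there are an enumeration `e` of the embeddings and an
isomorphism `φ` of groups under which the two actions correspond. -/
def HasGaloisGroup {n : ℕ} (G : Subgroup (Equiv.Perm (Fin n)))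
    (K : IntermediateField ℚ (AlgebraicClosure ℚ)) : Prop :=
  ∃ (e : (K →ₐ[ℚ] galoisClosure K) ≃ Fin n) (φ : Gal(galoisClosure K/ℚ) ≃* G),
    ∀ (σ : Gal(galoisClosure K/ℚ)) (τ : K →ₐ[ℚ] galoisClosure K),
      e ((σ : galoisClosure K →ₐ[ℚ] galoisClosure K).comp τ) =
        (φ σ : Equiv.Perm (Fin n)) (e τ)

/-- The number fields `K` (inside the fixed algebraic closure of `ℚ`) of degree `n`, with
`|Δ_K| ≤ X`, and with Galois group `G`. -/
def fields {n : ℕ} (G : Subgroup (Equiv.Perm (Fin n))) (X : ℝ) :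
    Set (IntermediateField ℚ (AlgebraicClosure ℚ)) :=
  {K | ∃ _ : NumberField K, Module.finrank ℚ K = n ∧
    |(NumberField.discr K : ℝ)| ≤ X ∧ HasGaloisGroup G K}

/-- The counting function `N_n(X; G)`. -/
def count {n : ℕ} (G : Subgroup (Equiv.Perm (Fin n))) (X : ℝ) : ℕ :=
  (fields G X).ncard

variable {n : ℕ} [NeZero n] (G : Subgroup (Equiv.Perm (Fin n)))

/-- `H = G ∩ S_{n-1}`, the stabilizer in `G` of the first letter (here the letter `0`). -/
abbrev pointStab : Subgroup G := MulAction.stabilizer G (0 : Fin n)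

/-- `N`, the normalizer of `H` in `G`. -/
abbrev normStab : Subgroup G := Subgroup.normalizer (pointStab G : Set G)

/-- `N / H`, which indexes the permutations `π_j` and the entries of the exponent vectors. -/
def NH : Type := normStab G ⧸ (pointStab G).subgroupOf (normStab G)

instance : Group (NH G) :=
  inferInstanceAs (Group (normStab G ⧸ (pointStab G).subgroupOf (normStab G)))

instance : Finite (NH G) :=
  inferInstanceAs (Finite (normStab G ⧸ (pointStab G).subgroupOf (normStab G)))

instance : Fintype (NH G) := Fintype.ofFinite _

/-- The class in `N / H` of an element of `N`. -/
def NH.mk (h : normStab G) : NH G :=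
  (QuotientGroup.mk h : normStab G ⧸ (pointStab G).subgroupOf (normStab G))

/-- `r = |N / H|`. -/
def r : ℕ := Nat.card (NH G)

/-- The product `(gH)(hH) = ghH` of a coset `gH ∈ G/H` with a coset `hH ∈ N/H`. -/
def mulCoset (c : NH G) (x : G ⧸ pointStab G) : G ⧸ pointStab G :=
  Quotient.liftOn₂' x c (fun (g : G) (h : normStab G) => (QuotientGroup.mk (g * (h : G)))) (by
    intro g₁ h₁ g₂ h₂ hg hh
    rw [QuotientGroup.leftRel_apply] at hg hh
    rw [Subgroup.mem_subgroupOf] at hh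
    rw [QuotientGroup.eq]
    have h1 : (h₁ : G)⁻¹ * (g₁⁻¹ * g₂) * (h₁ : G) ∈ pointStab G :=
      (Subgroup.mem_normalizer_iff''.mp h₁.2 _).mp hg
    have h2 := (pointStab G).mul_mem h1 hh
    have h3 : (h₁ : G)⁻¹ * (g₁⁻¹ * g₂) * (h₁ : G) * ((h₁⁻¹ * h₂ : normStab G) : G)
        = (g₁ * (h₁ : G))⁻¹ * (g₂ * (h₂ : G)) := by
      push_cast
      group
    rwa [h3] at h2)

theorem mulCoset_mk (h : normStab G) (g : G) :
    mulCoset G (NH.mk G h) (QuotientGroup.mk g) = QuotientGroup.mk (g * (h : G)) := rfl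

theorem mulCoset_bijective (c : NH G) : Function.Bijective (mulCoset G c) := by
  apply Finite.injective_iff_bijective.mp
  intro x y
  induction x using QuotientGroup.induction_on with | _ g₁
  induction y using QuotientGroup.induction_on with | _ g₂
  obtain ⟨h, rfl⟩ : ∃ h, NH.mk G h = c := Quotient.exists_rep c
  rw [mulCoset_mk, mulCoset_mk, QuotientGroup.eq, QuotientGroup.eq]
  intro hm
  apply (Subgroup.mem_normalizer_iff''.mp h.2 _).mpr
  simpa [mul_assoc] using hm

/-- For transitive `G`, the bijection `G/H ≃ [n]`, `gH ↦ g(1)` (the first letter is `0` here); the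
letter `i` corresponds to the coset `g_i H` of the elements that carry the first letter to `i`. -/
def cosetEquiv [MulAction.IsPretransitive G (Fin n)] : G ⧸ pointStab G ≃ Fin n :=
  Equiv.ofBijective (MulAction.ofQuotientStabilizer G (0 : Fin n))
    ⟨MulAction.injective_ofQuotientStabilizer G 0, fun i => by
      obtain ⟨g, hg⟩ := MulAction.exists_smul_eq G (0 : Fin n) i
      exact ⟨QuotientGroup.mk g, hg⟩⟩

/-- The permutation `π_j` of `[n]` attached to `j ∈ N/H`: if `j` is the class of `g_j`, then
`π_j(i)` is the letter `k` with `g_i g_j H = g_k H`. -/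
def perm [MulAction.IsPretransitive G (Fin n)] (j : NH G) : Equiv.Perm (Fin n) :=
  (cosetEquiv G).symm.trans ((Equiv.ofBijective _ (mulCoset_bijective G j)).trans (cosetEquiv G))

theorem perm_mk [MulAction.IsPretransitive G (Fin n)] (h : normStab G) (g : G) :
    perm G (NH.mk G h) ((g : Equiv.Perm (Fin n)) 0) = ((g * (h : G) : G) : Equiv.Perm (Fin n)) 0 := by
  have hg : (g : Equiv.Perm (Fin n)) 0 = cosetEquiv G (QuotientGroup.mk g) := rfl
  rw [hg]
  simp only [perm, Equiv.trans_apply, Equiv.symm_apply_apply, Equiv.ofBijective_apply, mulCoset_mk]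
  rfl

/-- The trace function `Tr_a = ∑ i, ∏ j, x_{π_j(i)} ^ a_j`. -/
def traceFn [MulAction.IsPretransitive G (Fin n)] (a : NH G → ℕ) : MvPolynomial (Fin n) ℤ :=
  ∑ i : Fin n, ∏ j : NH G, MvPolynomial.X (perm G j i) ^ a j

open Classical in
/-- The exponent vector `a(B)`: entry `t` at the trivial coset `1` (which is the first index),
entry `1` at the other elements of `B`, and entry `0` elsewhere. -/
def expVec (t : ℕ) (B : Finset (NH G)) : NH G → ℕ :=
  fun j => if j = 1 then t else if j ∈ B then 1 else 0

/-- The Jacobian matrix `(∂ f_i / ∂ x_j)` of `n` polynomials in `n` variables. -/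
def jacobian (f : Fin n → MvPolynomial (Fin n) ℤ) :
    Matrix (Fin n) (Fin n) (MvPolynomial (Fin n) ℤ) :=
  Matrix.of fun i j => MvPolynomial.pderiv j (f i)

end

end NumberFieldCount

/-!
The fields are counted through a small generator and the values of the `n` given trace functions
`f m` at its conjugates.

*A small generator.* A number field of degree `n` has a basis of integers all of whose conjugates
are `O(|Δ| ^ (1 / n))` (`NumberField.exists_integers_norm_embedding_pow_le`). This is sharper than
what Minkowski's theorem gives alone: his second theorem (`ZLattice.prod_successive_minima_le`)
bounds the product of the successive minima by `O(|Δ| ^ (1 / 2))`, and multiplying integers shows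
that the largest minimum is at most the product of the `i`-th from below and the `i`-th from above.
Combinations of the basis with bounded coefficients leave any fixed hypersurface in the space of
conjugates, so there is a generator `α` of that size avoiding a hypersurface that depends on `G`
and the `f m` only (`NumberField.exists_integer_aeval_conjugates_ne_zero`).

*Few generators for given values.* Since the Jacobian determinant does not vanish, the `f m` are
algebraically independent (`MvPolynomial.algebraicIndependent_of_jacobian`), so the variables are
algebraic over them: one nonzero polynomial `F` over `ℤ[y₁, …, yₙ]` has every variable as a root
once `y` is replaced by `f` (`MvPolynomial.exists_polynomial_eval₂_eq_zero`). The values `c m` of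
the `f m` at the conjugates of `α` are rational integers because the trace functions are
`G`-invariant. Then `α` is a root of the specialization of `F` at `c`, which is nonzero when `α`
avoids the zeros of the leading coefficient of `F` evaluated at `f`. So each `c` comes from at most
`deg F` generators.

*The count.* The `f m` are homogeneous of degree `k + t - 1`, so each `c m` is
`O(X ^ ((k + t - 1) / n))`, and there are `O(X ^ (k + t - 1))` vectors `c`.
-/

/-! ### Successive minima of lattices -/

theorem ZLattice.exists_min_norm_notMem {E : Type*} [NormedAddCommGroup E] [InnerProductSpace ℝ E]
    [FiniteDimensional ℝ E] (L : Submodule ℤ E) [DiscreteTopology L] [IsZLattice ℝ L]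
    (W : Submodule ℝ E) (hW : W ≠ ⊤) :
    ∃ x ∈ L, x ∉ W ∧ ∀ y ∈ L, y ∉ W → ‖x‖ ≤ ‖y‖ := by
  obtain ⟨x₀, hx₀L, hx₀W⟩ : ∃ x ∈ L, x ∉ W := by
    by_contra! h
    refine hW (top_le_iff.mp ?_)
    rw [← IsZLattice.span_top (K := ℝ) (L := L)]
    exact Submodule.span_le.mpr h
  have hcl : IsClosed (L : Set E) := by
    have : DiscreteTopology L.toAddSubgroup := inferInstanceAs (DiscreteTopology L)
    exact AddSubgroup.isClosed_of_discrete (H := L.toAddSubgroup)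
  have hfin : ({y ∈ (L : Set E) | y ∉ W ∧ ‖y‖ ≤ ‖x₀‖}).Finite := by
    have hd : IsDiscrete (L : Set E) := ⟨inferInstanceAs (DiscreteTopology L)⟩
    refine (Metric.finite_isBounded_inter_isClosed hd
      (Metric.isBounded_closedBall (x := (0 : E)) (r := ‖x₀‖)) hcl).subset ?_
    rintro y ⟨hy, -, hy'⟩
    exact ⟨by simpa using hy', hy⟩
  obtain ⟨x, hx, hmin⟩ := Set.exists_min_image _ (fun y : E => ‖y‖) hfin ⟨x₀, hx₀L, hx₀W, le_rfl⟩
  refine ⟨x, hx.1, hx.2.1, fun y hy hyW => ?_⟩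
  rcases le_total ‖y‖ ‖x₀‖ with h | h
  · exact hmin y ⟨hy, hyW, h⟩
  · exact hx.2.2.trans h

open Classical in
/-- Vectors realizing the successive minima of the lattice `L`, chosen greedily: `minVec L i` is a
shortest vector of `L` outside the real span of the earlier ones, or `0` if there is none. -/
noncomputable def ZLattice.minVec {E : Type*} [NormedAddCommGroup E] [InnerProductSpace ℝ E]
    (L : Submodule ℤ E) (i : ℕ) : E :=
  let W := Submodule.span ℝ (Set.range fun j : Fin i => ZLattice.minVec L j.1)
  if h : ∃ x ∈ L, x ∉ W ∧ ∀ y ∈ L, y ∉ W → ‖x‖ ≤ ‖y‖ then h.choose else 0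
termination_by i
decreasing_by exact j.2

open Module in
/-- A full lattice in a space of dimension `n` has linearly independent vectors `v 0, …, v (n - 1)`
realizing its successive minima: `v i` is at most as long as any lattice vector outside the span of
the earlier ones. -/
theorem ZLattice.exists_successive_minima {E : Type*} [NormedAddCommGroup E]
    [InnerProductSpace ℝ E] [FiniteDimensional ℝ E] (L : Submodule ℤ E) [DiscreteTopology L]
    [IsZLattice ℝ L] {n : ℕ} (hn : finrank ℝ E = n) :
    ∃ v : Fin n → E, (∀ i, v i ∈ L) ∧ LinearIndependent ℝ v ∧
      ∀ i, ∀ x ∈ L, x ∉ Submodule.span ℝ (v '' Set.Iio i) → ‖v i‖ ≤ ‖x‖ := by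
  have key : ∀ i < n,
      minVec L i ∈ L ∧ minVec L i ∉ Submodule.span ℝ (Set.range fun j : Fin i => minVec L j.1) ∧
      ∀ y ∈ L, y ∉ Submodule.span ℝ (Set.range fun j : Fin i => minVec L j.1) →
        ‖minVec L i‖ ≤ ‖y‖ := by
    intro i hi
    have hW : Submodule.span ℝ (Set.range fun j : Fin i => minVec L j.1) ≠ ⊤ := by
      intro h
      have h1 := finrank_range_le_card (R := ℝ) (fun j : Fin i => minVec L j.1)
      rw [Set.finrank, h, finrank_top, Fintype.card_fin] at h1
      omega
    have h := exists_min_norm_notMem L _ hW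
    have heq : minVec L i = h.choose := by
      rw [minVec]
      exact dif_pos h
    rw [heq]
    exact h.choose_spec
  have hspan : ∀ i : Fin n, (fun i : Fin n => minVec L i.1) '' Set.Iio i =
      Set.range fun j : Fin i => minVec L j.1 := by
    intro i
    ext x
    constructor
    · rintro ⟨j, hj, rfl⟩
      exact ⟨⟨j.1, hj⟩, rfl⟩
    · rintro ⟨j, rfl⟩
      exact ⟨⟨j.1, j.2.trans i.2⟩, j.2, rfl⟩
  refine ⟨fun i => minVec L i.1, fun i => (key i.1 i.2).1, ?_, fun i => ?_⟩
  · have : ∀ m ≤ n, LinearIndependent ℝ (fun i : Fin m => minVec L i.1) := by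
      intro m
      induction m with
      | zero => exact fun _ => linearIndependent_empty_type
      | succ m ih =>
        intro hm
        exact linearIndependent_finSucc'.mpr ⟨ih (by omega), (key m (by omega)).2.1⟩
    exact this n le_rfl
  · rw [hspan]
    exact (key i.1 i.2).2.2

theorem ZLattice.norm_le_norm_of_successive_minima {E : Type*} [NormedAddCommGroup E]
    [InnerProductSpace ℝ E] {L : Submodule ℤ E} {n : ℕ} {v : Fin n → E} (hvL : ∀ i, v i ∈ L)
    (hv : LinearIndependent ℝ v)
    (hmin : ∀ i, ∀ x ∈ L, x ∉ Submodule.span ℝ (v '' Set.Iio i) → ‖v i‖ ≤ ‖x‖)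
    {i j : Fin n} (hij : i ≤ j) : ‖v i‖ ≤ ‖v j‖ :=
  hmin i _ (hvL j) (hv.notMem_span_image (by simpa using hij))

open Module MeasureTheory in
/-- The upper bound in Minkowski's second theorem. The open box with half-sides `‖v i‖ / √n` along
the Gram-Schmidt directions of the successive minima `v` contains no nonzero lattice vector,
so its volume is at most `2 ^ n` times the covolume. -/
theorem ZLattice.prod_successive_minima_le {E : Type*} [NormedAddCommGroup E]
    [InnerProductSpace ℝ E] [FiniteDimensional ℝ E] [MeasurableSpace E] [BorelSpace E]
    (L : Submodule ℤ E) [DiscreteTopology L]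
    [IsZLattice ℝ L] {n : ℕ} (hn0 : 0 < n) (hn : finrank ℝ E = n)
    {v : Fin n → E} (hvL : ∀ i, v i ∈ L)
    (hv : LinearIndependent ℝ v)
    (hmin : ∀ i, ∀ x ∈ L, x ∉ Submodule.span ℝ (v '' Set.Iio i) → ‖v i‖ ≤ ‖x‖) :
    ∏ i, ‖v i‖ ≤ √n ^ n * ZLattice.covolume L := by
  by_contra! hlt
  have hnpos : 0 < √(n : ℝ) := by positivity
  let e : OrthonormalBasis (Fin n) ℝ E :=
    InnerProductSpace.gramSchmidtOrthonormalBasis (𝕜 := ℝ) (by simpa using hn) v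
  have htri : ∀ i j, i < j → inner ℝ (e j) (v i) = 0 := fun i j hij =>
    InnerProductSpace.gramSchmidtOrthonormalBasis_inv_triangular (𝕜 := ℝ) _ v hij
  -- For `x` in `S` with components along `e 0, …, e i` only, `‖x‖ < ‖v i‖`.
  let S : Set E := {x | ∀ i, |inner ℝ (e i) x| < ‖v i‖ / √n}
  let F := ZSpan.fundamentalDomain ((Free.chooseBasis ℤ L).ofZLatticeBasis ℝ L)
  have hF : IsAddFundamentalDomain L F volume := ZLattice.isAddFundamentalDomain _ _
  have hFvol : volume F = ENNReal.ofReal (ZLattice.covolume L) := by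
    rw [ZLattice.covolume_eq_measure_fundamentalDomain L volume hF, measureReal_def,
      ENNReal.ofReal_toReal]
    exact (Bornology.IsBounded.measure_lt_top (ZSpan.fundamentalDomain_isBounded _)).ne
  have hSvol : volume S = ENNReal.ofReal (∏ i, (2 * (‖v i‖ / √n))) := by
    have h1 : S = e.repr ⁻¹' (WithLp.ofLp ⁻¹'
        (Set.univ.pi fun i => Set.Ioo (-(‖v i‖ / √n)) (‖v i‖ / √n))) := by
      ext x
      simp [S, abs_lt, e.repr_apply_apply]
    have hm : MeasurableSet (Set.univ.pi fun i : Fin n =>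
        Set.Ioo (-(‖v i‖ / √n)) (‖v i‖ / √n)) :=
      MeasurableSet.univ_pi fun i => measurableSet_Ioo
    rw [h1, e.measurePreserving_repr.measure_preimage, 
      (PiLp.volume_preserving_ofLp (Fin n)).measure_preimage hm.nullMeasurableSet,
      Real.volume_pi_Ioo, ENNReal.ofReal_prod_of_nonneg]
    · congr! 2 with i
      ring_nf
    · intro i _; positivity
    · exact ((PiLp.volume_preserving_ofLp (Fin n)).measurable hm).nullMeasurableSet
  have hconv : Convex ℝ S := by
    have h1 : S = ⋂ i, (innerₗ E (e i)) ⁻¹' (Metric.ball 0 (‖v i‖ / √n)) := by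
      ext x
      simp [S]
    rw [h1]
    exact convex_iInter fun i => (convex_ball _ _).linear_preimage _
  have hsymm : ∀ x ∈ S, -x ∈ S := fun x hx i => by
    rw [inner_neg_right, abs_neg]
    exact hx i
  have hvol : volume F * 2 ^ finrank ℝ E < volume S := by
    rw [hFvol, hSvol, hn, show (2 : ENNReal) ^ n = ENNReal.ofReal (2 ^ n) by
      rw [ENNReal.ofReal_pow (by norm_num)]; norm_num, ← ENNReal.ofReal_mul (ZLattice.covolume_pos L volume).le]
    have h1 : ∏ i, (2 * (‖v i‖ / √n)) = 2 ^ n * ((∏ i, ‖v i‖) / √n ^ n) := by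
      simp [Finset.prod_mul_distrib, Finset.prod_div_distrib]
    have h2 : ZLattice.covolume L < (∏ i, ‖v i‖) / √n ^ n := by
      rw [lt_div_iff₀' (by positivity)]
      exact hlt
    have h3 := ZLattice.covolume_pos L volume
    refine (ENNReal.ofReal_lt_ofReal_iff ?_).mpr ?_
    · rw [h1]
      exact mul_pos (by positivity) (h3.trans h2)
    · rw [h1, mul_comm]
      exact mul_lt_mul_of_pos_left h2 (by positivity)
  have : Countable L.toAddSubgroup := inferInstanceAs (Countable L)
  obtain ⟨⟨x, hxL⟩, hx0, hxS⟩ := exists_ne_zero_mem_lattice_of_measure_mul_two_pow_lt_measure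
    (L := L.toAddSubgroup) (μ := volume) hF hsymm hconv hvol
  replace hx0 : x ≠ 0 := fun h => hx0 (Subtype.ext h)
  replace hxS : x ∈ S := hxS
  -- The largest `i` for which `x` has a component along `e i`.
  obtain ⟨i, hi, himax⟩ : ∃ i, inner ℝ (e i) x ≠ 0 ∧ ∀ j, i < j → inner ℝ (e j) x = 0 := by
    obtain ⟨i, hi, hmax⟩ := Set.exists_max_image {i | inner ℝ (e i) x ≠ 0} id (Set.toFinite _) (by
      by_contra h
      refine hx0 (e.repr.map_eq_zero_iff.mp ?_)
      ext i
      rw [e.repr_apply_apply]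
      have := Set.eq_empty_iff_forall_notMem.mp (Set.not_nonempty_iff_eq_empty.mp h) i
      simpa using this)
    refine ⟨i, hi, fun j hj => ?_⟩
    by_contra h
    exact absurd (hmax j h) (not_le.mpr hj)
  have hxnot : x ∉ Submodule.span ℝ (v '' Set.Iio i) := by
    intro hx
    have hle : Submodule.span ℝ (v '' Set.Iio i) ≤ LinearMap.ker (innerₗ E (e i)) := by
      rw [Submodule.span_le]
      rintro _ ⟨j, hj, rfl⟩
      exact htri j i hj
    exact hi (hle hx)
  have hnorm : ‖v i‖ ≤ ‖x‖ := hmin i x hxL hxnot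
  have hvi : 0 < ‖v i‖ := norm_pos_iff.mpr (hv.ne_zero i)
  have hsq : ‖x‖ ^ 2 < ‖v i‖ ^ 2 := by
    rw [← e.sum_sq_norm_inner_right x]
    have hne : (Finset.univ : Finset (Fin n)).Nonempty := ⟨i, Finset.mem_univ i⟩
    calc ∑ j, ‖inner ℝ (e j) x‖ ^ 2 < ∑ j : Fin n, ‖v i‖ ^ 2 / n := by
          refine Finset.sum_lt_sum_of_nonempty hne fun j _ => ?_
          rcases lt_or_ge i j with hij | hij
          · rw [himax j hij]
            simp only [norm_zero, ne_eq, OfNat.ofNat_ne_zero, not_false_eq_true, zero_pow]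
            positivity
          · calc ‖inner ℝ (e j) x‖ ^ 2 < (‖v j‖ / √n) ^ 2 :=
                  pow_lt_pow_left₀ (hxS j) (abs_nonneg _) two_ne_zero
              _ ≤ (‖v i‖ / √n) ^ 2 := by
                  gcongr
                  exact ZLattice.norm_le_norm_of_successive_minima hvL hv hmin hij
              _ = ‖v i‖ ^ 2 / n := by rw [div_pow, Real.sq_sqrt (Nat.cast_nonneg n)]
      _ = ‖v i‖ ^ 2 := by
          rw [Finset.sum_const, Finset.card_univ, Fintype.card_fin, nsmul_eq_mul]
          field_simp
  exact absurd hsq (not_lt.mpr (by gcongr))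

/-! ### Small integral bases of number fields -/

/-- The mixed embedding of a number field, as a `ℚ`-linear map into the Euclidean mixed space, in
which a complex place counts once. -/
noncomputable def NumberField.euclideanEmbedding (K : Type*) [Field K] [NumberField K] :
    K →ₗ[ℚ] mixedEmbedding.euclidean.mixedSpace K :=
  ((mixedEmbedding.euclidean.toMixed K).symm.toLinearMap.restrictScalars ℚ).comp
    (mixedEmbedding K).toRatAlgHom.toLinearMap

namespace NumberField

open scoped Classical

open Module mixedEmbedding InfinitePlace

variable {K : Type*} [Field K] [NumberField K]

theorem norm_euclideanEmbedding_sq (x : K) :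
    ‖euclideanEmbedding K x‖ ^ 2 = ∑ w : InfinitePlace K, w x ^ 2 := by
  classical
  have h1 : ∀ w : {w : InfinitePlace K // IsReal w},
      ‖(euclideanEmbedding K x).fst w‖ = w.1 x := fun w => by
    rw [← normAtPlace_apply w.1 x, normAtPlace_apply_of_isReal w.2]
    rfl
  have h2 : ∀ w : {w : InfinitePlace K // IsComplex w},
      ‖(euclideanEmbedding K x).snd w‖ = w.1 x := fun w => by
    rw [← normAtPlace_apply w.1 x, normAtPlace_apply_of_isComplex w.2]
    rfl
  rw [WithLp.prod_norm_sq_eq_of_L2, EuclideanSpace.norm_sq_eq, EuclideanSpace.norm_sq_eq]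
  simp_rw [h1, h2]
  rw [← Fintype.sum_subtype_add_sum_subtype (fun w : InfinitePlace K => IsReal w)]
  congr 1
  exact (Fintype.sum_equiv (Equiv.subtypeEquivRight fun w => not_isReal_iff_isComplex) _ _
    fun _ => rfl).symm

theorem norm_euclideanEmbedding_mul_le (x y : K) :
    ‖euclideanEmbedding K (x * y)‖ ≤ ‖euclideanEmbedding K x‖ * ‖euclideanEmbedding K y‖ := by
  refine le_of_sq_le_sq ?_ (mul_nonneg (norm_nonneg _) (norm_nonneg _))
  rw [mul_pow]
  simp_rw [norm_euclideanEmbedding_sq, map_mul, mul_pow]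
  rw [Finset.sum_mul]
  refine Finset.sum_le_sum fun w _ => ?_
  gcongr
  exact Finset.single_le_sum (f := fun w : InfinitePlace K => w y ^ 2) (fun _ _ => by positivity)
    (Finset.mem_univ w)

theorem norm_embedding_le_norm_euclideanEmbedding (σ : K →+* ℂ) (x : K) :
    ‖σ x‖ ≤ ‖euclideanEmbedding K x‖ := by
  refine le_of_sq_le_sq ?_ (norm_nonneg _)
  rw [norm_euclideanEmbedding_sq, ← InfinitePlace.apply σ x]
  exact Finset.single_le_sum (f := fun w : InfinitePlace K => w x ^ 2) (fun _ _ => by positivity)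
    (Finset.mem_univ _)

theorem mem_euclidean_integerLattice {v : euclidean.mixedSpace K} :
    v ∈ euclidean.integerLattice K ↔ ∃ x : 𝓞 K, euclideanEmbedding K x = v := by
  constructor
  · rintro ⟨x, hx⟩
    refine ⟨x, ?_⟩
    change (euclidean.toMixed K).symm (mixedEmbedding K x) = v
    rw [ContinuousLinearEquiv.symm_apply_eq]
    exact hx
  · rintro ⟨x, rfl⟩
    refine ⟨x, ?_⟩
    exact ((euclidean.toMixed K).apply_symm_apply _).symm

theorem covolume_euclidean_integerLattice_le :
    ZLattice.covolume (euclidean.integerLattice K) ≤ √|discr K| := by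
  classical
  rw [euclidean.integerLattice, ZLattice.covolume_comap _ _ _
    (euclidean.volumePreserving_toMixed K), covolume_integerLattice]
  refine mul_le_of_le_one_left (Real.sqrt_nonneg _) (pow_le_one₀ (by norm_num) (by norm_num))

/-- For a nonzero functional `φ` on a field extension, the form `(x, y) ↦ φ (x * y)` is
nondegenerate, so subspaces whose dimensions add up to more than the degree are not orthogonal. -/
theorem exists_apply_mul_ne_zero {k L : Type*} [Field k] [Field L] [Algebra k L]
    [FiniteDimensional k L] {φ : Dual k L} (hφ : φ ≠ 0) {s t : Set L}
    (h : finrank k L < finrank k (Submodule.span k s) + finrank k (Submodule.span k t)) :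
    ∃ x ∈ s, ∃ y ∈ t, φ (x * y) ≠ 0 := by
  by_contra! h0
  let T : L →ₗ[k] Dual k L := (LinearMap.mul k L).compr₂ φ
  have hT : Function.Injective T := by
    rw [← LinearMap.ker_eq_bot, LinearMap.ker_eq_bot']
    intro x hx
    by_contra hx0
    refine hφ (LinearMap.ext fun y => ?_)
    have := LinearMap.congr_fun hx (x⁻¹ * y)
    simpa [T, hx0] using this
  have hmap : (Submodule.span k s).map T ≤ (Submodule.span k t).dualAnnihilator := by
    rw [Submodule.map_span, Submodule.span_le]
    rintro _ ⟨x, hx, rfl⟩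
    rw [SetLike.mem_coe, Submodule.mem_dualAnnihilator]
    have hle : Submodule.span k t ≤ LinearMap.ker (T x) := by
      rw [Submodule.span_le]
      exact fun y hy => h0 x hx y hy
    exact fun y hy => hle hy
  have h1 := Submodule.finrank_mono hmap
  rw [← (Submodule.equivMapOfInjective T hT _).finrank_eq] at h1
  have h2 := Subspace.finrank_add_finrank_dualAnnihilator_eq (Submodule.span k t)
  omega

/-- A number field of degree `n` has a basis of integers all of whose conjugates are at most
`n * |discr K| ^ (1 / n)`. With `v` realizing the successive minima, `l` the last index and `φ` the
last coordinate, the form `φ (x * y)` cannot vanish on all products of one of `v 0, …, v i` with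
one of `v 0, …, v (l - i)`, so `‖v l‖ ≤ ‖v i‖ * ‖v (l - i)‖`. Multiplying over `i` bounds
`‖v l‖ ^ n` by the square of the product of the successive minima. -/
theorem exists_integers_norm_embedding_pow_le {n : ℕ} (hn : finrank ℚ K = n) :
    ∃ x : Fin n → 𝓞 K, LinearIndependent ℚ (fun i => (x i : K)) ∧
      ∀ i, ∀ σ : K →+* ℂ, ‖σ (x i)‖ ^ n ≤ n ^ n * |(discr K : ℝ)| := by
  have hn0 : 0 < n := hn ▸ finrank_pos
  have hnE : finrank ℝ (euclidean.mixedSpace K) = n := by rw [euclidean.finrank, hn]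
  obtain ⟨v, hvL, hv, hmin⟩ :=
    ZLattice.exists_successive_minima (euclidean.integerLattice K) hnE
  choose x hx using fun i => mem_euclidean_integerLattice.mp (hvL i)
  have hvx : v = fun i => euclideanEmbedding K (x i) := funext fun i => (hx i).symm
  have hxind : LinearIndependent ℚ (fun i => (x i : K)) := by
    have h1 : LinearIndependent ℚ v := hv.restrict_scalars' ℚ
    rw [hvx] at h1
    exact LinearIndependent.of_comp (euclideanEmbedding K) h1
  refine ⟨x, hxind, fun i σ => ?_⟩
  have : NeZero n := ⟨hn0.ne'⟩
  let l : Fin n := ⟨n - 1, by omega⟩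
  have hl : ∀ i, i ≤ l := fun i => by rw [Fin.le_def]; simp only [l]; omega
  let B : Basis (Fin n) ℚ K := basisOfLinearIndependentOfCardEqFinrank hxind (by simp [hn])
  have hB : ∀ i, B i = x i := fun i => by simp [B]
  let V : Basis (Fin n) ℝ (euclidean.mixedSpace K) :=
    basisOfLinearIndependentOfCardEqFinrank hv (by simp [hnE])
  have hV : ∀ i, V i = v i := fun i => by simp [V]
  have hcoord : ∀ y : K, V.coord l (euclideanEmbedding K y) = (B.coord l y : ℝ) := by
    have h : ((V.coord l).restrictScalars ℚ).comp (euclideanEmbedding K) =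
        (Algebra.linearMap ℚ ℝ).comp (B.coord l) := by
      refine B.ext fun j => ?_
      simp only [LinearMap.comp_apply, LinearMap.restrictScalars_apply]
      rw [hB, hx, ← hV, ← hB]
      simp [Finsupp.single_apply]
    exact fun y => LinearMap.congr_fun h y
  have hprod : ∀ i, ‖v l‖ ≤ ‖v i‖ * ‖v i.rev‖ := by
    intro i
    have hφ : B.coord l ≠ 0 := by
      intro h
      simpa using LinearMap.congr_fun h (B l)
    have hrank : ∀ i : Fin n, finrank ℚ (Submodule.span ℚ
        ((fun i => (x i : K)) '' Set.Iic i)) = i + 1 := by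
      intro i
      rw [Set.image_eq_range]
      exact (finrank_span_eq_card (hxind.comp _ (Subtype.val_injective (p := (· ∈ Set.Iic i))))).trans
        (by rw [← Set.toFinset_card, Set.toFinset_Iic, Fin.card_Iic])
    obtain ⟨_, ⟨a, ha, rfl⟩, _, ⟨b, hb, rfl⟩, hab⟩ := exists_apply_mul_ne_zero hφ
      (s := (fun i => (x i : K)) '' Set.Iic i) (t := (fun i => (x i : K)) '' Set.Iic i.rev) (by
        rw [hrank, hrank, hn, Fin.val_rev]
        omega)
    calc ‖v l‖ ≤ ‖euclideanEmbedding K (x a * x b)‖ := by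
          refine hmin l _ (mem_euclidean_integerLattice.mpr ⟨x a * x b, by simp⟩) fun h => hab ?_
          have hle : Submodule.span ℝ (v '' Set.Iio l) ≤ LinearMap.ker (V.coord l) := by
            rw [Submodule.span_le]
            rintro _ ⟨j, hj, rfl⟩
            rw [← hV]
            simpa [Finsupp.single_apply] using (ne_of_lt hj)
          have h1 := hle h
          rw [LinearMap.mem_ker, hcoord] at h1
          exact_mod_cast h1
      _ ≤ ‖euclideanEmbedding K (x a)‖ * ‖euclideanEmbedding K (x b)‖ :=
          norm_euclideanEmbedding_mul_le _ _
      _ = ‖v a‖ * ‖v b‖ := by rw [hx, hx]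
      _ ≤ ‖v i‖ * ‖v i.rev‖ := by
          gcongr
          · exact ZLattice.norm_le_norm_of_successive_minima hvL hv hmin ha
          · exact ZLattice.norm_le_norm_of_successive_minima hvL hv hmin hb
  have hcov := ZLattice.prod_successive_minima_le (euclidean.integerLattice K) hn0 hnE hvL hv hmin
  calc ‖σ (x i)‖ ^ n ≤ ‖v i‖ ^ n := by
        gcongr
        rw [← hx]
        exact norm_embedding_le_norm_euclideanEmbedding σ _
    _ ≤ ‖v l‖ ^ n := by
        gcongr
        exact ZLattice.norm_le_norm_of_successive_minima hvL hv hmin (hl i)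
    _ = ∏ _i : Fin n, ‖v l‖ := by simp
    _ ≤ ∏ i : Fin n, (‖v i‖ * ‖v i.rev‖) :=
        Finset.prod_le_prod (fun _ _ => norm_nonneg _) fun i _ => hprod i
    _ = (∏ i, ‖v i‖) ^ 2 := by
        rw [Finset.prod_mul_distrib, sq]
        congr 1
        exact Fintype.prod_equiv Fin.revPerm _ _ fun _ => rfl
    _ ≤ (√n ^ n * √|discr K|) ^ 2 := by
        gcongr
        exact hcov.trans (by gcongr; exact covolume_euclidean_integerLattice_le)
    _ = n ^ n * |(discr K : ℝ)| := by
        rw [mul_pow, ← pow_mul, mul_comm n 2, pow_mul, Real.sq_sqrt (Nat.cast_nonneg n),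
          Real.sq_sqrt (by positivity)]

end NumberField

/-! ### Algebraic independence and nonvanishing of polynomials -/

namespace MvPolynomial

/-- The chain rule for a polynomial evaluated at polynomials. -/
theorem pderiv_aeval {R σ τ : Type*} [CommRing R] [Fintype σ]
    (f : σ → MvPolynomial τ R) (j : τ) (Q : MvPolynomial σ R) :
    pderiv j (aeval f Q) = ∑ i, aeval f (pderiv i Q) * pderiv j (f i) := by
  classical
  induction Q using MvPolynomial.induction_on with
  | C a => simp [algebraMap_eq]
  | add p q hp hq => simp only [map_add, hp, hq, add_mul, Finset.sum_add_distrib]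
  | mul_X p i hp =>
    simp only [map_mul, aeval_X, Derivation.leibniz, smul_eq_mul, hp, map_add, pderiv_X]
    simp [add_mul, Finset.sum_add_distrib, Pi.single_apply, Finset.mul_sum, mul_assoc]

/-- Over a domain of characteristic zero, polynomials whose Jacobian determinant is not zero are
algebraically independent: differentiating a relation of least degree gives relations of smaller
degree among its partial derivatives. -/
theorem algebraicIndependent_of_jacobian {R : Type*} [CommRing R] [IsDomain R]
    [CharZero R] {n : ℕ} (f : Fin n → MvPolynomial (Fin n) R)
    (hJ : (Matrix.of fun i j => pderiv j (f i)).det ≠ 0) : AlgebraicIndependent R f := by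
  rw [algebraicIndependent_iff]
  intro Q
  induction hd : Q.totalDegree using Nat.strong_induction_on generalizing Q with
  | _ d ih =>
  intro hQ
  have hder : ∀ i, aeval f (pderiv i Q) = 0 := by
    have : (fun i => aeval f (pderiv i Q)) = 0 := by
      refine Matrix.eq_zero_of_vecMul_eq_zero hJ ?_
      ext1 j
      have := pderiv_aeval f j Q
      rw [hQ, map_zero] at this
      simpa [Matrix.vecMul, dotProduct] using this.symm
    exact fun i => congrFun this i
  by_cases hd0 : d = 0
  · subst hd0
    rw [totalDegree_eq_zero_iff_eq_C.mp hd] at hQ ⊢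
    rw [aeval_C, algebraMap_eq] at hQ
    rw [C_eq_zero.mp hQ, map_zero]
  · exfalso
    have hz : ∀ i, pderiv i Q = 0 := by
      intro i
      by_contra hne
      refine hne (ih _ ?_ _ rfl (hder i))
      rw [← hd, totalDegree, Finset.sup_lt_iff (by rw [bot_eq_zero]; omega)]
      intro s hs
      rw [mem_support_iff, coeff_pderiv] at hs
      have h1 := le_totalDegree (mem_support_iff.mpr (left_ne_zero_of_mul hs))
      rw [Finsupp.sum_add_index' (fun _ => rfl) (fun _ _ _ => rfl),
        Finsupp.sum_single_index rfl] at h1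
      omega
    refine hd0 ?_
    rw [← hd, totalDegree_eq_zero_iff]
    intro m hm i
    by_contra hmi
    have h1 := coeff_pderiv (i := i) Q (m - Finsupp.single i 1)
    rw [hz, coeff_zero, tsub_add_cancel_of_le (by simpa using Nat.one_le_iff_ne_zero.mpr hmi)] at h1
    rcases mul_eq_zero.mp h1.symm with h2 | h2
    · exact mem_support_iff.mp hm h2
    · exact Nat.cast_add_one_ne_zero _ h2

/-- Each variable is algebraically dependent on `n` given polynomials in `n` variables, by a count
of transcendence degrees; one nonzero relation can be taken for all the variables. -/
theorem exists_polynomial_eval₂_eq_zero {n : ℕ}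
    (f : Fin n → MvPolynomial (Fin n) ℤ) :
    ∃ F : Polynomial (MvPolynomial (Fin n) ℤ), F ≠ 0 ∧
      ∀ j, Polynomial.eval₂ (aeval f : _ →ₐ[ℤ] MvPolynomial (Fin n) ℤ).toRingHom (X j) F = 0 := by
  have h1 : ∀ j, ∃ F : Polynomial (MvPolynomial (Fin n) ℤ), F ≠ 0 ∧
      Polynomial.eval₂ (aeval f : _ →ₐ[ℤ] MvPolynomial (Fin n) ℤ).toRingHom (X j) F = 0 := by
    intro j
    have hdep : ¬ AlgebraicIndependent ℤ
        (fun o : Option (Fin n) => o.elim (X j : MvPolynomial (Fin n) ℤ) f) := by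
      intro h
      have := h.cardinalMk_le_trdeg
      rw [trdeg_of_isDomain] at this
      simp at this
    rw [algebraicIndependent_iff] at hdep
    push Not at hdep
    obtain ⟨p, hp, hp0⟩ := hdep
    refine ⟨optionEquivLeft ℤ (Fin n) p, by simpa using hp0, ?_⟩
    rw [← hp]
    clear hp hp0
    induction p using MvPolynomial.induction_on with
    | C a => rw [optionEquivLeft_C, Polynomial.eval₂_C, aeval_C]; exact aeval_C f a
    | add p q hp hq => simp only [map_add, Polynomial.eval₂_add, hp, hq]
    | mul_X p i hp =>
      simp only [map_mul, Polynomial.eval₂_mul, hp]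
      cases i <;> simp
  choose F hF0 hF using h1
  refine ⟨∏ j, F j, Finset.prod_ne_zero_iff.mpr fun j _ => hF0 j, fun j => ?_⟩
  rw [Polynomial.eval₂_finsetProd]
  exact Finset.prod_eq_zero (Finset.mem_univ j) (hF j)

/-- A nonzero polynomial does not vanish on the image, under an invertible matrix, of the whole
grid `{0, …, d}ⁿ` when `d` is at least its total degree. -/
theorem exists_aeval_mulVec_ne_zero {n : ℕ} {P : MvPolynomial (Fin n) ℤ} (hP : P ≠ 0)
    {k : Type*} [Field k] [CharZero k] (M : Matrix (Fin n) (Fin n) k) (hM : IsUnit M.det) :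
    ∃ c : Fin n → ℕ, (∀ i, c i ≤ P.totalDegree) ∧
      aeval (M.mulVec fun i => (c i : k)) P ≠ 0 := by
  classical
  by_contra! h
  let l : Fin n → MvPolynomial (Fin n) k := fun i => ∑ j, C (M i j) * X j
  have hl : ∀ x : Fin n → k, eval x (aeval l P) = aeval (M.mulVec x) P := by
    intro x
    clear h hP
    induction P using MvPolynomial.induction_on with
    | C a => simp
    | add p q hp hq => simp only [map_add, hp, hq]
    | mul_X p i hp => simp [hp, l, Matrix.mulVec, dotProduct]
  have h0 : aeval l P = 0 := by
    refine eq_zero_of_eval_zero_at_prod_finset _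
      (fun _ => (Finset.range (P.totalDegree + 1)).image (Nat.cast : ℕ → k)) (fun i => ?_) ?_
    · rw [Finset.card_image_of_injective _ Nat.cast_injective, Finset.card_range, Nat.lt_succ_iff]
      refine (degreeOf_le_totalDegree _ i).trans ?_
      rw [aeval_def, eval₂_eq]
      refine totalDegree_finsetSum_le fun s hs => ?_
      have hmul : ∀ i, (l i).totalDegree ≤ 1 := fun i =>
        totalDegree_finsetSum_le fun j _ => (totalDegree_mul _ _).trans (by simp)
      calc _ ≤ 0 + (∏ i ∈ s.support, l i ^ s i).totalDegree := by
            refine (totalDegree_mul _ _).trans ?_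
            gcongr
            rw [show algebraMap ℤ (MvPolynomial (Fin n) k) (coeff s P) =
              C ((coeff s P : ℤ) : k) by simp, totalDegree_C]
        _ ≤ ∑ i ∈ s.support, s i := by
            rw [zero_add]
            refine (totalDegree_finsetProd _ _).trans (Finset.sum_le_sum fun j _ => ?_)
            calc _ ≤ s j * (l j).totalDegree := totalDegree_pow _ _
              _ ≤ s j * 1 := by gcongr; exact hmul j
              _ = s j := mul_one _
        _ ≤ P.totalDegree := le_totalDegree hs
    · intro x hx
      simp only [Finset.mem_image, Finset.mem_range, Nat.lt_succ_iff] at hx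
      choose c hc hcx using hx
      rw [hl, show x = fun i => (c i : k) from _root_.funext fun i => (hcx i).symm]
      exact h c hc
  refine hP (map_injective (Int.castRingHom k) Int.cast_injective ?_)
  rw [map_zero]
  refine funext fun y => ?_
  have h1 := hl (M⁻¹.mulVec y)
  rw [h0, Matrix.mulVec_mulVec, Matrix.mul_nonsing_inv M hM, Matrix.one_mulVec] at h1
  rw [eval_map, map_zero]
  simpa [aeval_def] using h1.symm

end MvPolynomial

/-! ### Integers with conjugates off a hypersurface -/

open MvPolynomial Module NumberField in
/-- A number field of degree `n` contains an integer at whose conjugates a given nonzero polynomial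
does not vanish, and whose conjugates are at most a constant times `|discr K| ^ (1 / n)`. -/
theorem NumberField.exists_integer_aeval_conjugates_ne_zero {K L : Type*} [Field K] [NumberField K]
    [Field L] [Algebra ℚ L] {n : ℕ} (hn : finrank ℚ K = n) (e : (K →ₐ[ℚ] L) ≃ Fin n)
    {P : MvPolynomial (Fin n) ℤ} (hP : P ≠ 0) {Y : ℝ} (hY : 0 ≤ Y)
    (hdisc : |(discr K : ℝ)| ≤ Y ^ n) :
    ∃ α : 𝓞 K, aeval (fun i => e.symm i (α : K)) P ≠ 0 ∧
      ∀ σ : K →+* ℂ, ‖σ α‖ ≤ n ^ 2 * P.totalDegree * Y := by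
  have : CharZero L := algebraRat.charZero L
  have hn0 : n ≠ 0 := hn ▸ finrank_pos.ne'
  obtain ⟨x, hx, hxle⟩ := NumberField.exists_integers_norm_embedding_pow_le hn
  have hxY : ∀ i, ∀ σ : K →+* ℂ, ‖σ (x i)‖ ≤ n * Y := fun i σ => by
    refine le_of_pow_le_pow_left₀ hn0 (by positivity) ((hxle i σ).trans ?_)
    rw [mul_pow]
    gcongr
  let B : Basis (Fin n) ℚ K := by
    have : Nonempty (Fin n) := ⟨⟨0, Nat.pos_of_ne_zero hn0⟩⟩
    exact basisOfLinearIndependentOfCardEqFinrank hx (by simp [hn])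
  have hB : ∀ i, B i = x i := fun i => by simp [B]
  let M : Matrix (Fin n) (Fin n) L := Matrix.of fun i j => e.symm i (x j : K)
  have hM : IsUnit M.det := by
    rw [← Matrix.isUnit_iff_isUnit_det, ← Matrix.linearIndependent_rows_iff_isUnit]
    have h1 := (linearIndependent_algHom_toLinearMap ℚ K L).comp _ e.symm.injective
    rw [Fintype.linearIndependent_iff] at h1 ⊢
    intro g hg
    refine h1 g (B.ext fun j => ?_)
    have := congrFun hg j
    simpa [M, hB, Matrix.row] using this
  obtain ⟨c, hc, hcP⟩ := exists_aeval_mulVec_ne_zero hP M hM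
  refine ⟨∑ j, (c j : 𝓞 K) * x j, ?_, fun σ => ?_⟩
  · have h1 : (fun i => e.symm i ((∑ j, (c j : 𝓞 K) * x j : 𝓞 K) : K)) =
        M.mulVec fun j => (c j : L) := by
      ext i
      simp [M, Matrix.mulVec, dotProduct, mul_comm]
    rwa [h1]
  · calc ‖σ ((∑ j, (c j : 𝓞 K) * x j : 𝓞 K) : K)‖ = ‖∑ j, (c j : ℂ) * σ (x j)‖ := by simp
      _ ≤ ∑ j : Fin n, (P.totalDegree : ℝ) * (n * Y) := by
          refine (norm_sum_le _ _).trans (Finset.sum_le_sum fun j _ => ?_)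
          rw [norm_mul, Complex.norm_natCast]
          gcongr
          · exact_mod_cast hc j
          · exact hxY j σ
      _ = n ^ 2 * P.totalDegree * Y := by
          rw [Finset.sum_const, Finset.card_univ, Fintype.card_fin, nsmul_eq_mul]
          ring

/-! ### Trace functions at the conjugates of an integer -/

namespace NumberFieldCount

open MvPolynomial Module

variable {n : ℕ}

section Trace

variable [NeZero n] (G : Subgroup (Equiv.Perm (Fin n))) [MulAction.IsPretransitive G (Fin n)]

/-- The permutations `π_j` commute with `G`: they come from right multiplication on `G / H`. -/
theorem perm_apply_comm (j : NH G) (g : G) (i : Fin n) :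
    perm G j ((g : Equiv.Perm (Fin n)) i) = (g : Equiv.Perm (Fin n)) (perm G j i) := by
  obtain ⟨h, rfl⟩ : ∃ h, NH.mk G h = j := Quotient.exists_rep j
  obtain ⟨g₀, rfl⟩ := MulAction.exists_smul_eq G (0 : Fin n) i
  have h1 := perm_mk G h (g * g₀)
  have h2 := perm_mk G h g₀
  change perm G (NH.mk G h) ((g : Equiv.Perm (Fin n)) ((g₀ : Equiv.Perm (Fin n)) 0)) =
    (g : Equiv.Perm (Fin n)) (perm G (NH.mk G h) ((g₀ : Equiv.Perm (Fin n)) 0))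
  rw [h2]
  exact h1

theorem aeval_traceFn {A : Type*} [CommRing A] (y : Fin n → A) (a : NH G → ℕ) :
    aeval y (traceFn G a) = ∑ i, ∏ j, y (perm G j i) ^ a j := by
  simp [traceFn]

theorem aeval_traceFn_comp {A : Type*} [CommRing A] (y : Fin n → A) (a : NH G → ℕ) (g : G) :
    aeval (y ∘ (g : Equiv.Perm (Fin n))) (traceFn G a) = aeval y (traceFn G a) := by
  rw [aeval_traceFn, aeval_traceFn]
  refine Fintype.sum_equiv (g : Equiv.Perm (Fin n)) _ _ fun i => ?_
  simp [perm_apply_comm]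

theorem norm_aeval_traceFn_le (y : Fin n → ℂ) (a : NH G → ℕ) {R : ℝ} (hy : ∀ i, ‖y i‖ ≤ R) :
    ‖aeval y (traceFn G a)‖ ≤ n * R ^ ∑ j, a j := by
  rw [aeval_traceFn]
  calc ‖∑ i, ∏ j, y (perm G j i) ^ a j‖ ≤ ∑ i : Fin n, R ^ ∑ j, a j := by
        refine (norm_sum_le _ _).trans (Finset.sum_le_sum fun i _ => ?_)
        rw [norm_prod, ← Finset.prod_pow_eq_pow_sum]
        refine Finset.prod_le_prod (fun _ _ => norm_nonneg _) fun j _ => ?_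
        rw [norm_pow]
        gcongr
        exact hy _
    _ = n * R ^ ∑ j, a j := by simp

omit [MulAction.IsPretransitive G (Fin n)] in
/-- The trace function of `expVec G t B` is homogeneous of degree `k + t - 1`. -/
theorem sum_expVec {t k : ℕ} (hk : 1 ≤ k) {B : Finset (NH G)} (hB : B.card = k) (h1 : 1 ∈ B) :
    ∑ j, expVec G t B j = k + t - 1 := by
  classical
  rw [← Finset.add_sum_erase _ _ (Finset.mem_univ (1 : NH G))]
  have h2 : ∑ j ∈ Finset.univ.erase (1 : NH G), expVec G t B j = (B.erase 1).card := by
    rw [Finset.card_eq_sum_ones, ← Finset.sum_subset (Finset.erase_subset_erase 1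
      (Finset.subset_univ B))]
    · refine Finset.sum_congr rfl fun j hj => ?_
      simp [expVec, Finset.ne_of_mem_erase hj, Finset.mem_of_mem_erase hj]
    · intro j hj hjB
      have := Finset.ne_of_mem_erase hj
      simp_all [expVec]
  rw [h2, Finset.card_erase_of_mem h1, hB, expVec, if_pos rfl]
  omega

variable {K L : Type*} [Field K] [NumberField K] [Field L] [Algebra ℚ L] [FiniteDimensional ℚ L]

/-- The trace functions take rational integer values at the conjugates of an integer, because `G`
acts on the conjugates and the trace functions are `G`-invariant. -/
theorem exists_int_eq_aeval_traceFn [IsGalois ℚ L]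
    (e : (K →ₐ[ℚ] L) ≃ Fin n) (φ : Gal(L/ℚ) ≃* G)
    (he : ∀ (σ : Gal(L/ℚ)) (τ : K →ₐ[ℚ] L),
      e ((σ : L →ₐ[ℚ] L).comp τ) = (φ σ : Equiv.Perm (Fin n)) (e τ))
    (α : NumberField.RingOfIntegers K) (a : NH G → ℕ) :
    ∃ c : ℤ, aeval (fun i => e.symm i (α : K)) (traceFn G a) = (c : L) := by
  have hfix : ∀ σ : Gal(L/ℚ), σ (aeval (fun i => e.symm i (α : K)) (traceFn G a)) =
      aeval (fun i => e.symm i (α : K)) (traceFn G a) := by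
    intro σ
    have hσ : ∀ i, σ (e.symm i (α : K)) = e.symm ((φ σ : Equiv.Perm (Fin n)) i) (α : K) := by
      intro i
      have := he σ (e.symm i)
      rw [Equiv.apply_symm_apply, ← Equiv.eq_symm_apply] at this
      rw [← this]
      rfl
    conv_rhs => rw [← aeval_traceFn_comp G _ a (φ σ)]
    rw [aeval_traceFn, aeval_traceFn]
    simp [hσ]
  obtain ⟨q, hq⟩ := (IsGalois.mem_range_algebraMap_iff_fixed _).mpr hfix
  have hint : IsIntegral ℤ (aeval (fun i => e.symm i (α : K)) (traceFn G a)) := by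
    rw [aeval_traceFn]
    refine IsIntegral.sum _ fun i _ => IsIntegral.prod _ fun j _ => IsIntegral.pow ?_ _
    exact (NumberField.RingOfIntegers.isIntegral_coe α).map ((e.symm _).restrictScalars ℤ)
  rw [← hq, isIntegral_algebraMap_iff (algebraMap ℚ L).injective,
    IsIntegrallyClosed.isIntegral_iff] at hint
  obtain ⟨c, rfl⟩ := hint
  exact ⟨c, by rw [← hq]; simp⟩

/-- A number field with Galois group `G` is generated by a root of a specialization of `F` at
integers of bounded size, namely the values of the trace functions at the conjugates of a suitable
element. The polynomial `P` must not vanish at these conjugates: its factor from the leading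
coefficient of `F` keeps the specialization nonzero, and its factors `X i - X j` keep the conjugates
distinct. -/
theorem exists_generator [IsNormalClosure ℚ K L] (hn : finrank ℚ K = n)
    (e : (K →ₐ[ℚ] L) ≃ Fin n) (φ : Gal(L/ℚ) ≃* G)
    (he : ∀ (σ : Gal(L/ℚ)) (τ : K →ₐ[ℚ] L),
      e ((σ : L →ₐ[ℚ] L).comp τ) = (φ σ : Equiv.Perm (Fin n)) (e τ))
    {a : Fin n → NH G → ℕ} {w : ℕ} (hw : ∀ m, ∑ j, a m j = w)
    {F : Polynomial (MvPolynomial (Fin n) ℤ)}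
    (hF : ∀ j, Polynomial.eval₂ (aeval (fun m => traceFn G (a m)) :
      _ →ₐ[ℤ] MvPolynomial (Fin n) ℤ).toRingHom (X j) F = 0)
    {P : MvPolynomial (Fin n) ℤ} (hP : P ≠ 0)
    (hPF : aeval (fun m => traceFn G (a m)) F.leadingCoeff ∣ P)
    (hPX : ∀ i j : Fin n, i ≠ j → X i - X j ∣ P)
    {Y : ℝ} (hY : 0 ≤ Y) (hdisc : |(NumberField.discr K : ℝ)| ≤ Y ^ n) :
    ∃ (c : Fin n → ℤ) (α : K), (∀ m, |(c m : ℝ)| ≤ n * (n ^ 2 * P.totalDegree * Y) ^ w) ∧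
      F.map (eval c) ≠ 0 ∧ Polynomial.aeval α (F.map (eval c)) = 0 ∧
      IntermediateField.adjoin ℚ {α} = ⊤ := by
  have : CharZero L := algebraRat.charZero L
  have : Normal ℚ L := IsNormalClosure.normal (K := K)
  have : IsGalois ℚ L := IsGalois.mk
  obtain ⟨α, hαP, hα⟩ :=
    NumberField.exists_integer_aeval_conjugates_ne_zero hn e hP hY hdisc
  choose c hc using fun m => exists_int_eq_aeval_traceFn G e φ he α (a m)
  set y : Fin n → L := fun i => e.symm i (α : K) with hy
  have hcomp : ∀ Q : MvPolynomial (Fin n) ℤ,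
      aeval y (aeval (fun m => traceFn G (a m)) Q) = ((eval c Q : ℤ) : L) := by
    intro Q
    induction Q using MvPolynomial.induction_on with
    | C a => simp
    | add p q hp hq => simp only [map_add, hp, hq, Int.cast_add]
    | mul_X p i hp => simp only [map_mul, hp, aeval_X, hc, eval_X, Int.cast_mul]
  refine ⟨c, α, fun m => ?_, fun h0 => ?_, ?_, ?_⟩
  · let ι : L →+* ℂ := (IsAlgClosed.lift (R := ℚ) (S := L) (M := ℂ)).toRingHom
    have h1 : aeval (fun i => ι (y i)) (traceFn G (a m)) = (c m : ℂ) := by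
      rw [← map_intCast ι, ← hc m, aeval_traceFn, aeval_traceFn]
      simp
    rw [← hw m, ← Complex.norm_intCast, ← h1]
    exact norm_aeval_traceFn_le G _ _ fun i => hα (ι.comp (e.symm i : K →+* L))
  · refine hαP ?_
    obtain ⟨Q, rfl⟩ := hPF
    have h1 := congrArg (fun p => Polynomial.coeff p F.natDegree) h0
    simp only [Polynomial.coeff_map, Polynomial.coeff_zero, Polynomial.coeff_natDegree] at h1
    rw [map_mul, hcomp, h1, Int.cast_zero, zero_mul]
  -- The relation holds at every conjugate; pulling it back along one embedding gives it at `α`.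
  · obtain ⟨i⟩ : Nonempty (Fin n) := ⟨0⟩
    have hring : (aeval y : _ →ₐ[ℤ] L).toRingHom.comp (aeval (fun m => traceFn G (a m)) :
        _ →ₐ[ℤ] MvPolynomial (Fin n) ℤ).toRingHom = (Int.castRingHom L).comp (eval c) :=
      RingHom.ext hcomp
    have h1 := congrArg (aeval y : _ →ₐ[ℤ] L).toRingHom (hF i)
    rw [Polynomial.hom_eval₂, hring, map_zero, ← Polynomial.eval₂_map] at h1
    refine (e.symm i).toRingHom.injective ?_
    rw [map_zero (e.symm i).toRingHom, ← h1, Polynomial.aeval_def, Polynomial.hom_eval₂]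
    congr 1
    · exact Subsingleton.elim _ _
    · simp [hy]
  · refine (Field.primitive_element_iff_algHom_eq_of_eval' ℚ L
      (fun x => IsNormalClosure.splits x) _).mpr fun τ τ' hτ => ?_
    by_contra hne
    refine hαP ?_
    obtain ⟨Q, hQ⟩ := hPX (e τ) (e τ') (e.injective.ne hne)
    rw [hQ, map_mul, map_sub, aeval_X, aeval_X, hy]
    simp only [Equiv.symm_apply_apply]
    rw [show τ α = τ' α from hτ, sub_self, zero_mul]

end Trace

/-! ### Counting fields -/

/-- The `ℚ`-algebra structure that instance search finds on `AlgebraicClosure ℚ` is the one of a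
characteristic zero division ring, for which there is no `Normal` instance. -/
theorem normal_algebraicClosure_rat : Normal ℚ (AlgebraicClosure ℚ) :=
  @IsAlgClosure.normal ℚ (AlgebraicClosure ℚ) _ _ (AlgebraicClosure.instAlgebra ℚ) _

theorem isNormalClosure_galoisClosure (K : IntermediateField ℚ (AlgebraicClosure ℚ)) :
    IsNormalClosure ℚ K (galoisClosure K) := by
  have : Nonempty (K →ₐ[ℚ] AlgebraicClosure ℚ) := ⟨K.val⟩
  have : Normal ℚ (AlgebraicClosure ℚ) := normal_algebraicClosure_rat
  exact isNormalClosure_normalClosure (F := ℚ) (K := K) (L := AlgebraicClosure ℚ)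

theorem finiteDimensional_galoisClosure (K : IntermediateField ℚ (AlgebraicClosure ℚ))
    [NumberField K] : FiniteDimensional ℚ (galoisClosure K) :=
  normalClosure.is_finiteDimensional ℚ K (AlgebraicClosure ℚ)

theorem eq_adjoin_of_adjoin_eq_top {K : IntermediateField ℚ (AlgebraicClosure ℚ)} {α : K}
    (h : IntermediateField.adjoin ℚ {α} = ⊤) :
    K = IntermediateField.adjoin ℚ {(α : AlgebraicClosure ℚ)} := by
  have h1 : IntermediateField.lift (F := K) (IntermediateField.adjoin ℚ {α}) =
      IntermediateField.lift (F := K) ⊤ := congrArg (IntermediateField.lift (F := K)) h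
  exact (IntermediateField.lift_top _ K).symm.trans
    (h1.symm.trans (IntermediateField.lift_adjoin_simple ℚ K α))

open Classical in
/-- The fields generated over `ℚ` by a root of a specialization of `F` at integers in `[-N, N]`. -/
noncomputable def rootFields {n : ℕ} (F : Polynomial (MvPolynomial (Fin n) ℤ)) (N : ℕ) :
    Finset (IntermediateField ℚ (AlgebraicClosure ℚ)) :=
  (Fintype.piFinset fun _ : Fin n => Finset.Icc (-(N : ℤ)) N).biUnion fun c =>
    ((F.map (eval c)).aroots (AlgebraicClosure ℚ)).toFinset.image
      fun β => IntermediateField.adjoin ℚ {β}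

theorem card_rootFields_le {n : ℕ} (F : Polynomial (MvPolynomial (Fin n) ℤ)) (N : ℕ) :
    (rootFields F N).card ≤ (2 * N + 1) ^ n * F.natDegree := by
  classical
  refine (Finset.card_biUnion_le_card_mul _ _ F.natDegree fun c _ => ?_).trans (le_of_eq ?_)
  · refine Finset.card_image_le.trans ((Multiset.toFinset_card_le _).trans ?_)
    refine (Polynomial.card_roots' _).trans ?_
    exact (Polynomial.natDegree_map_le).trans Polynomial.natDegree_map_le
  · rw [Fintype.card_piFinset]
    simp only [Int.card_Icc, Finset.prod_const, Finset.card_univ, Fintype.card_fin]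
    congr 2
    omega

theorem mem_rootFields {n : ℕ} {F : Polynomial (MvPolynomial (Fin n) ℤ)} {N : ℕ}
    {K : IntermediateField ℚ (AlgebraicClosure ℚ)} {c : Fin n → ℤ} {α : K}
    (hc : ∀ m, |c m| ≤ N) (hF : F.map (eval c) ≠ 0)
    (hα : Polynomial.aeval α (F.map (eval c)) = 0) (h : IntermediateField.adjoin ℚ {α} = ⊤) :
    K ∈ rootFields F N := by
  classical
  simp only [rootFields, Finset.mem_biUnion, Finset.mem_image, Multiset.mem_toFinset,
    Fintype.mem_piFinset, Finset.mem_Icc]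
  refine ⟨c, fun m => abs_le.mp (hc m), α, ?_, (eq_adjoin_of_adjoin_eq_top h).symm⟩
  rw [Polynomial.mem_aroots]
  refine ⟨hF, ?_⟩
  have hcomp : K.val.toRingHom.comp (algebraMap ℤ K) = algebraMap ℤ (AlgebraicClosure ℚ) :=
    RingHom.ext_int _ _
  have h1 := congrArg K.val.toRingHom hα
  rw [map_zero, Polynomial.aeval_def, Polynomial.hom_eval₂, hcomp] at h1
  exact h1

end NumberFieldCount

theorem theoremA (n : ℕ) [NeZero n] (G : Subgroup (Equiv.Perm (Fin n)))
    [MulAction.IsPretransitive G (Fin n)] (k t : ℕ) (ht : 2 ≤ t)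
    (hk : 1 ≤ k) (hkr : k < NumberFieldCount.r G)
    (hl : n ≤ (NumberFieldCount.r G - 1).choose (k - 1))
    (hJ : ∃ B : Fin n → Finset (NumberFieldCount.NH G), Function.Injective B ∧
      (∀ i, (B i).card = k ∧ 1 ∈ B i) ∧
      (NumberFieldCount.jacobian fun i =>
        NumberFieldCount.traceFn G (NumberFieldCount.expVec G t (B i))).det ≠ 0) :
    ∃ C : ℝ, ∀ X : ℝ, 1 ≤ X → (NumberFieldCount.fields G X).Finite ∧
      (NumberFieldCount.count G X : ℝ) ≤ C * X ^ (k + t - 1) := by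
  classical
  obtain ⟨B, -, hB, hdet⟩ := hJ
  have hind := MvPolynomial.algebraicIndependent_of_jacobian _ hdet
  obtain ⟨F, hF0, hF⟩ := MvPolynomial.exists_polynomial_eval₂_eq_zero
    fun m => NumberFieldCount.traceFn G (NumberFieldCount.expVec G t (B m))
  -- The polynomial that must not vanish at the conjugates of the generator.
  set P : MvPolynomial (Fin n) ℤ :=
    MvPolynomial.aeval (fun m => NumberFieldCount.traceFn G (NumberFieldCount.expVec G t (B m)))
      F.leadingCoeff *
      ∏ i : Fin n, ∏ j ∈ Finset.univ.erase i, (MvPolynomial.X i - MvPolynomial.X j) with hPdef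
  have hP : P ≠ 0 := by
    refine mul_ne_zero (fun h => ?_) ?_
    · exact hF0 (Polynomial.leadingCoeff_eq_zero.mp ((algebraicIndependent_iff.mp hind) _ h))
    · refine Finset.prod_ne_zero_iff.mpr fun i _ => Finset.prod_ne_zero_iff.mpr fun j hj => ?_
      rw [sub_ne_zero]
      exact (MvPolynomial.X_injective (R := ℤ)).ne (Finset.ne_of_mem_erase hj).symm
  have hPX : ∀ i j : Fin n, i ≠ j → (MvPolynomial.X i - MvPolynomial.X j) ∣ P := fun i j hij =>
    ((Finset.dvd_prod_of_mem (fun j => (MvPolynomial.X i - MvPolynomial.X j :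
      MvPolynomial (Fin n) ℤ)) (Finset.mem_erase.mpr ⟨hij.symm, Finset.mem_univ j⟩)).trans
      (Finset.dvd_prod_of_mem (fun i => ∏ j ∈ Finset.univ.erase i,
        (MvPolynomial.X i - MvPolynomial.X j : MvPolynomial (Fin n) ℤ))
        (Finset.mem_univ i))).mul_left _
  set D : ℕ := P.totalDegree
  refine ⟨(2 * (n * (n ^ 2 * D : ℝ) ^ (k + t - 1)) + 1) ^ n * F.natDegree, fun X hX => ?_⟩
  have hX0 : 0 ≤ X := zero_le_one.trans hX
  set Y : ℝ := X ^ (n : ℝ)⁻¹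
  have hYn : Y ^ n = X := Real.rpow_inv_natCast_pow hX0 (NeZero.ne n)
  have hY : 1 ≤ Y := Real.one_le_rpow hX (by positivity)
  -- The conjugates of the generator are at most `n ^ 2 * D * Y`, so the values of the trace
  -- functions at them are at most `N`.
  set N : ℕ := ⌊(n * (n ^ 2 * D * Y) ^ (k + t - 1) : ℝ)⌋₊
  have hsub : NumberFieldCount.fields G X ⊆ NumberFieldCount.rootFields F N := by
    rintro K ⟨_, hn, hdisc, e, φ, he⟩
    have := NumberFieldCount.isNormalClosure_galoisClosure K
    have := NumberFieldCount.finiteDimensional_galoisClosure K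
    obtain ⟨c, α, hc, hFc, hα, htop⟩ := NumberFieldCount.exists_generator G hn e φ he
      (fun m => NumberFieldCount.sum_expVec (t := t) G hk (hB m).1 (hB m).2) hF hP
      (Dvd.intro _ rfl) hPX (zero_le_one.trans hY) (hdisc.trans hYn.ge)
    refine NumberFieldCount.mem_rootFields (fun m => ?_) hFc hα htop
    rw [Int.abs_eq_natAbs]
    refine Int.ofNat_le.mpr (Nat.le_floor ?_)
    rw [Nat.cast_natAbs, Int.cast_abs]
    exact hc m
  refine ⟨(Finset.finite_toSet _).subset hsub, ?_⟩
  have hN : (2 * N + 1 : ℝ) ≤ (2 * (n * (n ^ 2 * D : ℝ) ^ (k + t - 1)) + 1) * Y ^ (k + t - 1) := by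
    have h1 : (N : ℝ) ≤ n * (n ^ 2 * D * Y) ^ (k + t - 1) := Nat.floor_le (by positivity)
    have h2 : 1 ≤ Y ^ (k + t - 1) := one_le_pow₀ hY
    rw [mul_pow] at h1
    linarith
  have hcard : NumberFieldCount.count G X ≤ (2 * N + 1) ^ n * F.natDegree := by
    refine le_trans ?_ (NumberFieldCount.card_rootFields_le F N)
    rw [← Set.ncard_coe_finset]
    exact Set.ncard_le_ncard hsub (Finset.finite_toSet _)
  calc (NumberFieldCount.count G X : ℝ) ≤ (2 * N + 1 : ℝ) ^ n * F.natDegree := by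
        exact_mod_cast hcard
    _ ≤ ((2 * (n * (n ^ 2 * D : ℝ) ^ (k + t - 1)) + 1) * Y ^ (k + t - 1)) ^ n * F.natDegree := by
        gcongr
    _ = _ := by
        rw [mul_pow, ← pow_mul Y, mul_comm (k + t - 1) n, pow_mul Y, hYn]
        ring
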